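/- Let $A\subset\mathbb R^2$ be a set of seven distinct points, no four on a line and not all seven on one conic (the zero set of a real polynomial of degree $2$, possibly reducible). Notation. Let $I_{1,3}(A)$ be the space of real polynomials in $x,y$ of degree at most $3$ vanishing on $A$; let $I_{2,6}(A)$ be the space of real polynomials of degree at most $6$ which vanish on $A$ together with both first partial derivatives; and let $I_{1,3}^2(A)=\{\sum_i f_ig_i : f_i,g_i\in I_{1,3}(A)\}\subseteq I_{2,6}(A)$ (finite sums). Let $\tilde A$ be the set of points of $\mathbb R^2\smallsetminus A$ at which all members of $I_{1,3}(A)$ vanish, and let $\tilde{\mathcal A}$ be the set of points of the real projective plane, other than the points $(a:1)$ with $a\in A$, at which the cubic homogenizations of all members of $I_{1,3}(A)$ vanish. Call $A$ full if for all $\pi\in A$ and $v\in\mathbb R^2$ there is $f\in I_{1,3}(A)$ with $\nabla f(\pi)=v$. A polynomial is positive if it takes only nonnegative values on $\mathbb R^2$, and sos if it is a sum of squares of real polynomials. Say that Hilbert's Method applies to $A$ with the basis $f_1,\dots,f_s$ of $I_{1,3}(A)$ and the polynomial $g$ if $A$ is finite, $\tilde A$ is finite, $A$ is full, the degree $6$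 homogenization of $\sum_j f_j^2$ has no nontrivial real zero on the line at infinity, $g\in I_{2,6}(A)\smallsetminus I_{1,3}^2(A)$, and $g(w)>0$ for all $w\in\tilde A$. Say that Hilbert's Method applies to $A$ if it does so with some basis of $I_{1,3}(A)$ and some $g$. Then Hilbert's Method applies to $A$. More precisely, $I_{2,6}(A)\smallsetminus I_{1,3}^2(A)$ is non-empty, and for every basis $f_1,\dots,f_s$ of $I_{1,3}(A)$ and every $g\in I_{2,6}(A)\smallsetminus I_{1,3}^2(A)$, Hilbert's Method applies to $A$ with this basis and this $g$, and there is $c>0$ such that $\sum_j f_j^2+c\,g$ is positive and not sos. Consequently there is a positive polynomial $p(x,y)$ of degree $6$ which vanishes on $A$ and is not sos. Moreover, $A$ is full and $\tilde{\mathcal A}=\emptyset$ (there are no forced zeros, even at infinity), and $\dim I_{1,3}(A)=3$, $\dim I_{1,3}^2(A)\le 6$, $\dim I_{2,6}(A)\ge 7$. -/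

import Mathlib

namespace HilbertMethod

open MvPolynomial

variable {n : ℕ}

/-- `I_{1,d}(A)`: the real polynomials of degree at most `d` that vanish on `A`. -/
def vanishingSpace (d : ℕ) (A : Set (Fin n → ℝ)) : Submodule ℝ (MvPolynomial (Fin n) ℝ) where
  carrier := {p | p.totalDegree ≤ d ∧ ∀ a ∈ A, eval a p = 0}
  zero_mem' := by simp
  add_mem' := by
    rintro p q ⟨hp, hp'⟩ ⟨hq, hq'⟩
    refine ⟨(totalDegree_add p q).trans (max_le hp hq), fun a ha => ?_⟩
    simp [hp' a ha, hq' a ha]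
  smul_mem' := by
    rintro c p ⟨hp, hp'⟩
    refine ⟨(totalDegree_smul_le c p).trans hp, fun a ha => ?_⟩
    simp [smul_eval, hp' a ha]

/-- `I_{2,d}(A)`: the real polynomials of degree at most `d` that vanish, together with all their
first order partial derivatives, on `A`. -/
def singularSpace (d : ℕ) (A : Set (Fin n → ℝ)) : Submodule ℝ (MvPolynomial (Fin n) ℝ) where
  carrier := {p | p.totalDegree ≤ d ∧
    ∀ a ∈ A, eval a p = 0 ∧ ∀ i, eval a (pderiv i p) = 0}
  zero_mem' := by simp
  add_mem' := by
    rintro p q ⟨hp, hp'⟩ ⟨hq, hq'⟩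
    refine ⟨(totalDegree_add p q).trans (max_le hp hq), fun a ha => ⟨?_, fun i => ?_⟩⟩
    · simp [(hp' a ha).1, (hq' a ha).1]
    · simp [(hp' a ha).2 i, (hq' a ha).2 i]
  smul_mem' := by
    rintro c p ⟨hp, hp'⟩
    refine ⟨(totalDegree_smul_le c p).trans hp, fun a ha => ⟨?_, fun i => ?_⟩⟩
    · simp [smul_eval, (hp' a ha).1]
    · simp [smul_eval, (hp' a ha).2 i]

/-- `I_{1,d}(A)²`: the finite sums `∑ fᵢ gᵢ` with `fᵢ, gᵢ ∈ I_{1,d}(A)`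
(the product of submodules of an algebra). -/
noncomputable def vanishingSpaceSq (d : ℕ) (A : Set (Fin n → ℝ)) :
    Submodule ℝ (MvPolynomial (Fin n) ℝ) :=
  vanishingSpace d A * vanishingSpace d A

/-- `I_{1,d}(A)` is full: every vector is the gradient at every point of `A` of some member. -/
def IsFull (d : ℕ) (A : Set (Fin n → ℝ)) : Prop :=
  ∀ a ∈ A, ∀ v : Fin n → ℝ, ∃ f ∈ vanishingSpace d A, ∀ i, eval a (pderiv i f) = v i

/-- The homogenization `x_{n+1}^d p(x₁/x_{n+1}, …, xₙ/x_{n+1})` of a polynomial of degree at most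
`d` as a form of degree `d`; the new variable is the last one. -/
noncomputable def homogenize (d : ℕ) (p : MvPolynomial (Fin n) ℝ) :
    MvPolynomial (Fin (n + 1)) ℝ :=
  ∑ i ∈ Finset.range (d + 1),
    rename Fin.castSucc (homogeneousComponent i p) * X (Fin.last n) ^ (d - i)

/-- The vector `(x₁, …, xₙ, t)`. -/
def extendVec (x : Fin n → ℝ) (t : ℝ) : Fin (n + 1) → ℝ :=
  Fin.snoc (α := fun _ => ℝ) x t

/-- The affine forced zeros: points outside `A` at which all of `I_{1,d}(A)` vanishes. -/
def forcedZeros (d : ℕ) (A : Set (Fin n → ℝ)) : Set (Fin n → ℝ) :=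
  {x | ∀ p ∈ vanishingSpace d A, eval x p = 0} \ A

/-- The projective forced zeros, as a set of nonzero vectors: nonzero common zeros of the degree `d`
homogenizations of the members of `I_{1,d}(A)`, not proportional to `(a, 1)` for any `a ∈ A`. -/
def projForcedZeros (d : ℕ) (A : Set (Fin n → ℝ)) : Set (Fin (n + 1) → ℝ) :=
  {u | u ≠ 0 ∧ (∀ p ∈ vanishingSpace d A, eval u (homogenize d p) = 0) ∧
    ∀ a ∈ A, ∀ t : ℝ, u ≠ t • extendVec a 1}

/-- `p`, regarded as a polynomial of degree `d`, has no zeros at infinity: the homogenization of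
degree `d` has no nontrivial zero on the hyperplane `x_{n+1} = 0`. -/
def NoZerosAtInfinity (d : ℕ) (p : MvPolynomial (Fin n) ℝ) : Prop :=
  ∀ x : Fin n → ℝ, x ≠ 0 → eval (extendVec x 0) (homogenize d p) ≠ 0

/-- `p` is positive (positive semidefinite): it takes only nonnegative values. -/
def IsPsd (p : MvPolynomial (Fin n) ℝ) : Prop :=
  ∀ x : Fin n → ℝ, 0 ≤ eval x p

/-- `∑ⱼ fⱼ²` for a basis `f₁, …, f_s` of `I_{1,d}(A)`. -/
noncomputable def sumSqBasis {d : ℕ} {A : Set (Fin n → ℝ)} {s : ℕ}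
    (f : Module.Basis (Fin s) ℝ (vanishingSpace d A)) : MvPolynomial (Fin n) ℝ :=
  ∑ j, (f j : MvPolynomial (Fin n) ℝ) ^ 2

/-- The conditions under which Hilbert's Method can be carried out for the set `A`, the basis
`f₁, …, f_s` of `I_{1,d}(A)` and the perturbing polynomial `g`. -/
structure HilbertConditions (d : ℕ) (A : Set (Fin n → ℝ)) {s : ℕ}
    (f : Module.Basis (Fin s) ℝ (vanishingSpace d A)) (g : MvPolynomial (Fin n) ℝ) : Prop where
  finite : A.Finite
  finite_forcedZeros : (forcedZeros d A).Finite
  full : IsFull d A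
  noZerosAtInfinity : NoZerosAtInfinity (2 * d) (sumSqBasis f)
  mem_singularSpace : g ∈ singularSpace (2 * d) A
  notMem_vanishingSpaceSq : g ∉ vanishingSpaceSq d A
  pos_forcedZeros : ∀ w ∈ forcedZeros d A, 0 < eval w g

/-- Hilbert's Method applies to `A` in degree `d`. -/
def HilbertsMethodApplies (d : ℕ) (A : Set (Fin n → ℝ)) : Prop :=
  ∃ (s : ℕ) (f : Module.Basis (Fin s) ℝ (vanishingSpace d A)) (g : MvPolynomial (Fin n) ℝ),
    HilbertConditions d A f g

end HilbertMethod

open HilbertMethod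

/-! Seven points impose dependent conditions on the six-dimensional space of conics, so some `p ∈ A`
can be dropped: every conic through the other six points also passes through `p`, hence is zero
(`exists_noConicOffPoint`). Conics therefore interpolate arbitrary values on `A \ {p}`. This allows
a correction along lines. For a line `m = 0` through `p` and a cubic `f`, a conic `q` agreeing with
`f / m` at the points of `A` off the line makes `f - m q` vanish there without changing `f` on the
line (`NoConicOffPoint.exists_sub_mul`). So it is enough to treat the at most three points of `A` on
one line, where products of lines suffice. This gives independence of the seven conditions on
cubics, absence of projective forced zeros and, together with a separate case for the points that do
not play the role of `p`, fullness. The dimension of the cubics through `A` is thus 10 - 7 = 3,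
their products span at most 6 dimensions, and the sextics singular on `A` have dimension at least 28
- 21 = 7, so a suitable `g` exists. Positivity for small `c` is a compactness argument on the unit
sphere of homogeneous coordinates: near a point of `A`, `g` vanishes to second order while fullness
makes `∑ fⱼ²` grow quadratically; elsewhere `∑ fⱼ²` is positive (`exists_abs_homogenize_le`). If the
perturbed sextic were a sum of squares, each summand would have degree at most 3 and vanish on `A`;
this would put `g` in the square of the space of cubics (`not_isSumSq_perturbation`). -/

namespace HilbertMethod

open MvPolynomial Finset

/-! ### Homogenization and its values in affine charts and at infinity -/

section Homogenization

variable {n : ℕ}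

lemma extendVec_castSucc (x : Fin n → ℝ) (t : ℝ) (i : Fin n) :
    extendVec x t i.castSucc = x i := by
  simp [extendVec]

lemma extendVec_last (x : Fin n → ℝ) (t : ℝ) : extendVec x t (Fin.last n) = t := by
  simp [extendVec]

lemma exists_eq_extendVec (u : Fin (n + 1) → ℝ) : ∃ x t, u = extendVec x t :=
  ⟨Fin.init u, u (Fin.last n), (Fin.snoc_init_self u).symm⟩

lemma eval_homogenize (d : ℕ) (p : MvPolynomial (Fin n) ℝ) (x : Fin n → ℝ) (t : ℝ) :
    eval (extendVec x t) (homogenize d p) =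
      ∑ i ∈ range (d + 1), eval x (homogeneousComponent i p) * t ^ (d - i) := by
  have h : (extendVec x t) ∘ Fin.castSucc = x := funext fun i => extendVec_castSucc x t i
  simp [homogenize, map_sum, eval_rename, h, extendVec_last]

lemma homogenize_add (d : ℕ) (p q : MvPolynomial (Fin n) ℝ) :
    homogenize d (p + q) = homogenize d p + homogenize d q := by
  simp [homogenize, add_mul, sum_add_distrib]

lemma homogenize_smul (d : ℕ) (c : ℝ) (p : MvPolynomial (Fin n) ℝ) :
    homogenize d (c • p) = c • homogenize d p := by
  simp [homogenize, smul_sum]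

lemma homogenize_sub (d : ℕ) (p q : MvPolynomial (Fin n) ℝ) :
    homogenize d (p - q) = homogenize d p - homogenize d q := by
  simp [homogenize, sub_mul]

lemma homogenize_sum {ι : Type*} (d : ℕ) (s : Finset ι) (p : ι → MvPolynomial (Fin n) ℝ) :
    homogenize d (∑ j ∈ s, p j) = ∑ j ∈ s, homogenize d (p j) := by
  simp only [homogenize, map_sum, sum_mul]
  exact sum_comm

lemma sum_homogeneousComponent_of_totalDegree_le {d : ℕ} {p : MvPolynomial (Fin n) ℝ}
    (hp : p.totalDegree ≤ d) : ∑ i ∈ range (d + 1), homogeneousComponent i p = p := by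
  conv_rhs => rw [← sum_homogeneousComponent p]
  symm
  apply sum_subset
  · intro i hi
    simp only [mem_range] at hi ⊢
    omega
  · intro i _ hi
    simp only [mem_range, not_lt] at hi
    exact homogeneousComponent_eq_zero _ _ (by omega)

lemma eval_smul_of_isHomogeneous {d : ℕ} {p : MvPolynomial (Fin n) ℝ} (hp : p.IsHomogeneous d)
    (t : ℝ) (x : Fin n → ℝ) : eval (t • x) p = t ^ d * eval x p := by
  rw [eval_eq, eval_eq, mul_sum]
  refine sum_congr rfl fun s hs => ?_
  have h : s.degree = d := by
    rw [Finsupp.degree_eq_weight_one]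
    exact hp (mem_support_iff.mp hs)
  have : ∏ i ∈ s.support, (t • x) i ^ s i = t ^ d * ∏ i ∈ s.support, x i ^ s i := by
    simp only [Pi.smul_apply, smul_eq_mul, mul_pow, prod_mul_distrib]
    rw [prod_pow_eq_pow_sum, ← h]
    rfl
  rw [this]
  ring

lemma eval_homogenize_of_ne_zero {d : ℕ} {p : MvPolynomial (Fin n) ℝ} (hp : p.totalDegree ≤ d)
    (x : Fin n → ℝ) {t : ℝ} (ht : t ≠ 0) :
    eval (extendVec x t) (homogenize d p) = t ^ d * eval (t⁻¹ • x) p := by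
  rw [eval_homogenize]
  conv_rhs => rw [← sum_homogeneousComponent_of_totalDegree_le hp]
  rw [map_sum, mul_sum]
  refine sum_congr rfl fun i hi => ?_
  rw [eval_smul_of_isHomogeneous (homogeneousComponent_isHomogeneous i p)]
  have hi' : i ≤ d := by simpa [Nat.lt_succ_iff] using hi
  have : t ^ d = t ^ (d - i) * t ^ i := by rw [← pow_add]; congr 1; omega
  rw [this, inv_pow]
  field_simp

lemma eval_homogenize_one {d : ℕ} {p : MvPolynomial (Fin n) ℝ} (hp : p.totalDegree ≤ d)
    (x : Fin n → ℝ) : eval (extendVec x 1) (homogenize d p) = eval x p := by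
  simp [eval_homogenize_of_ne_zero hp x one_ne_zero]

lemma eval_homogenize_zero (d : ℕ) (p : MvPolynomial (Fin n) ℝ) (x : Fin n → ℝ) :
    eval (extendVec x 0) (homogenize d p) = eval x (homogeneousComponent d p) := by
  rw [eval_homogenize, sum_range_succ]
  simp only [Nat.sub_self, pow_zero, mul_one]
  rw [sum_eq_zero, zero_add]
  intro i hi
  rw [mem_range] at hi
  rw [zero_pow (by omega), mul_zero]

lemma continuous_eval_homogenize (d : ℕ) (p : MvPolynomial (Fin n) ℝ) (x : Fin n → ℝ) :
    Continuous fun t : ℝ => eval (extendVec x t) (homogenize d p) := by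
  simp only [eval_homogenize]
  fun_prop

/-- Off the hyperplane at infinity this is multiplicativity of affine evaluation; continuity in the
last coordinate extends it to infinity. -/
lemma eval_homogenize_mul {d e : ℕ} {p q : MvPolynomial (Fin n) ℝ} (hp : p.totalDegree ≤ d)
    (hq : q.totalDegree ≤ e) (u : Fin (n + 1) → ℝ) :
    eval u (homogenize (d + e) (p * q)) = eval u (homogenize d p) * eval u (homogenize e q) := by
  obtain ⟨x, t, rfl⟩ := exists_eq_extendVec u
  have key := Continuous.ext_on (dense_compl_singleton (0 : ℝ))
    (continuous_eval_homogenize (d + e) (p * q) x)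
    ((continuous_eval_homogenize d p x).mul (continuous_eval_homogenize e q x)) (by
      intro s hs
      have hs' : s ≠ 0 := hs
      have hpq : (p * q).totalDegree ≤ d + e := (totalDegree_mul p q).trans (add_le_add hp hq)
      simp only [Pi.mul_apply]
      rw [eval_homogenize_of_ne_zero hpq x hs', eval_homogenize_of_ne_zero hp x hs',
        eval_homogenize_of_ne_zero hq x hs', map_mul, pow_add]
      ring)
  exact congrFun key t

lemma isHomogeneous_homogenize (d : ℕ) (p : MvPolynomial (Fin n) ℝ) :
    (homogenize d p).IsHomogeneous d := by
  refine IsHomogeneous.sum _ _ _ fun i hi => ?_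
  have hi' : i + (d - i) = d := by
    rw [mem_range] at hi
    omega
  have := ((homogeneousComponent_isHomogeneous i p).rename_isHomogeneous
    (f := (Fin.castSucc : Fin n → Fin (n + 1)))).mul (isHomogeneous_X_pow (R := ℝ) (Fin.last n) (d - i))
  rwa [hi'] at this

end Homogenization

/-! ### Dimension counts for plane polynomials -/

section Dimension

/-- Monomials are counted as lattice points of a triangle, a form that `decide` can evaluate. -/
lemma finrank_restrictTotalDegree_two (d : ℕ) :
    Module.finrank ℝ (restrictTotalDegree (Fin 2) ℝ d) =
      #{x ∈ range (d + 1) ×ˢ range (d + 1) | x.1 + x.2 ≤ d} := by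
  have h := Module.finrank_eq_nat_card_basis
    (basisRestrictSupport ℝ {k : Fin 2 →₀ ℕ | (k.sum fun _ e => e) ≤ d})
  refine h.trans ?_
  let f : (Fin 2 →₀ ℕ) → ℕ × ℕ := fun k => (k 0, k 1)
  have hf : Function.Injective f := by
    intro k l hkl
    simp only [f, Prod.mk.injEq] at hkl
    ext i
    fin_cases i
    · exact hkl.1
    · exact hkl.2
  rw [Nat.card_coe_set_eq, ← Set.ncard_image_of_injective _ hf, ← Set.ncard_coe_finset]
  congr 1
  ext ⟨a, b⟩
  simp only [Set.mem_image, Set.mem_ofPred_eq, coe_filter, mem_product, mem_range, f,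
    Prod.mk.injEq]
  constructor
  · rintro ⟨k, hk, rfl, rfl⟩
    rw [Finsupp.sum_fintype _ _ (fun _ => rfl), Fin.sum_univ_two] at hk
    omega
  · rintro ⟨_, h⟩
    refine ⟨Finsupp.equivFunOnFinite.symm ![a, b], ?_, by simp, by simp⟩
    rw [Finsupp.sum_fintype _ _ (fun _ => rfl), Fin.sum_univ_two]
    simpa using h

/-- Evaluation of the polynomials of degree at most `d` at the points of a finite set. -/
noncomputable def evalOn (d : ℕ) (B : Finset (Fin 2 → ℝ)) :
    restrictTotalDegree (Fin 2) ℝ d →ₗ[ℝ] (B → ℝ) :=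
  (LinearMap.pi fun b : B => (aeval (b : Fin 2 → ℝ)).toLinearMap) ∘ₗ Submodule.subtype _

lemma evalOn_apply (d : ℕ) (B : Finset (Fin 2 → ℝ)) (p : restrictTotalDegree (Fin 2) ℝ d) (b : B) :
    evalOn d B p b = eval (b : Fin 2 → ℝ) (p : MvPolynomial (Fin 2) ℝ) := by
  simp [evalOn, aeval_eq_eval]

lemma finrank_vanishingSpace_eq (d : ℕ) (B : Finset (Fin 2 → ℝ)) :
    Module.finrank ℝ (vanishingSpace d (B : Set (Fin 2 → ℝ))) =
      Module.finrank ℝ (LinearMap.ker (evalOn d B)) := by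
  suffices h : vanishingSpace d (B : Set (Fin 2 → ℝ)) =
      (LinearMap.ker (evalOn d B)).map (Submodule.subtype _) by
    rw [h, Submodule.finrank_map_subtype_eq]
  ext p
  simp only [Submodule.mem_map, LinearMap.mem_ker]
  constructor
  · rintro ⟨hd, hv⟩
    refine ⟨⟨p, (mem_restrictTotalDegree _ _ _).2 hd⟩, ?_, rfl⟩
    ext b
    rw [evalOn_apply]
    exact hv b b.2
  · rintro ⟨q, hq, rfl⟩
    refine ⟨(mem_restrictTotalDegree _ _ _).1 q.2, fun a ha => ?_⟩
    have := congrFun hq ⟨a, ha⟩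
    rwa [evalOn_apply] at this

/-- Each point imposes three linear conditions: the value and two partial derivatives. -/
lemma finrank_singularSpace_ge (d : ℕ) (B : Finset (Fin 2 → ℝ)) :
    Module.finrank ℝ (restrictTotalDegree (Fin 2) ℝ d) ≤
      Module.finrank ℝ (singularSpace d (B : Set (Fin 2 → ℝ))) + 3 * #B := by
  let D : restrictTotalDegree (Fin 2) ℝ d →ₗ[ℝ] (B × Fin 2 → ℝ) :=
    (LinearMap.pi fun b : B × Fin 2 => (aeval (b.1 : Fin 2 → ℝ)).toLinearMap ∘ₗ
      (pderiv b.2).toLinearMap) ∘ₗ Submodule.subtype _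
  have hD : ∀ p b, D p b = eval (b.1 : Fin 2 → ℝ) (pderiv b.2 (p : MvPolynomial (Fin 2) ℝ)) := by
    intro p b
    simp [D, aeval_eq_eval]
  let T := (evalOn d B).prod D
  have h1 := LinearMap.finrank_range_add_finrank_ker T
  have h2 : Module.finrank ℝ (LinearMap.range T) ≤ 3 * #B := by
    refine (Submodule.finrank_le _).trans (le_of_eq ?_)
    simp
    ring
  have h3 : Module.finrank ℝ (singularSpace d (B : Set (Fin 2 → ℝ))) =
      Module.finrank ℝ (LinearMap.ker T) := by
    suffices h : singularSpace d (B : Set (Fin 2 → ℝ)) =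
        (LinearMap.ker T).map (Submodule.subtype _) by
      rw [h, Submodule.finrank_map_subtype_eq]
    ext p
    simp only [Submodule.mem_map, LinearMap.mem_ker]
    constructor
    · rintro ⟨hd, hv⟩
      refine ⟨⟨p, (mem_restrictTotalDegree _ _ _).2 hd⟩, ?_, rfl⟩
      refine Prod.ext (funext fun b => ?_) (funext fun b => ?_)
      · exact (evalOn_apply _ _ _ _).trans (hv b b.2).1
      · exact (hD _ _).trans ((hv b.1 b.1.2).2 b.2)
    · rintro ⟨q, hq, rfl⟩
      refine ⟨(mem_restrictTotalDegree _ _ _).1 q.2, fun a ha => ⟨?_, fun i => ?_⟩⟩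
      · exact (evalOn_apply _ _ _ ⟨a, ha⟩).symm.trans (congrFun (congrArg Prod.fst hq) ⟨a, ha⟩)
      · exact (hD _ (⟨a, ha⟩, i)).symm.trans (congrFun (congrArg Prod.snd hq) (⟨a, ha⟩, i))
  omega

instance finite_vanishingSpace (d : ℕ) (B : Set (Fin 2 → ℝ)) :
    Module.Finite ℝ (vanishingSpace d B) :=
  Submodule.finiteDimensional_of_le (S₂ := restrictTotalDegree (Fin 2) ℝ d)
    fun _ hp => (mem_restrictTotalDegree _ _ _).2 hp.1

end Dimension

end HilbertMethod

namespace HilbertMethod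

open MvPolynomial Finset

/-! ### Lines and products of lines -/

section LinearForm

/-- The polynomial `c₀ x + c₁ y + c₂`. -/
noncomputable def linearForm (c : Fin 3 → ℝ) : MvPolynomial (Fin 2) ℝ :=
  C (c 0) * X 0 + C (c 1) * X 1 + C (c 2)

lemma totalDegree_linearForm_le (c : Fin 3 → ℝ) : (linearForm c).totalDegree ≤ 1 := by
  refine (totalDegree_add _ _).trans (max_le ((totalDegree_add _ _).trans (max_le ?_ ?_)) ?_)
  · exact (totalDegree_mul _ _).trans (by simp)
  · exact (totalDegree_mul _ _).trans (by simp)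
  · simp

lemma eval_linearForm (c : Fin 3 → ℝ) (a : Fin 2 → ℝ) :
    eval a (linearForm c) = c 0 * a 0 + c 1 * a 1 + c 2 := by
  simp [linearForm]

lemma eval_pderiv_linearForm_zero (c : Fin 3 → ℝ) (a : Fin 2 → ℝ) :
    eval a (pderiv 0 (linearForm c)) = c 0 := by
  simp [linearForm]

lemma eval_pderiv_linearForm_one (c : Fin 3 → ℝ) (a : Fin 2 → ℝ) :
    eval a (pderiv 1 (linearForm c)) = c 1 := by
  simp [linearForm]

lemma eval_homogenize_linearForm (c u : Fin 3 → ℝ) :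
    eval u (homogenize 1 (linearForm c)) = c 0 * u 0 + c 1 * u 1 + c 2 * u 2 := by
  obtain ⟨x, t, rfl⟩ := exists_eq_extendVec u
  have e0 : extendVec x t 0 = x 0 := extendVec_castSucc x t 0
  have e1 : extendVec x t 1 = x 1 := extendVec_castSucc x t 1
  have e2 : extendVec x t 2 = t := extendVec_last x t
  have hX : ∀ i : Fin 2, homogeneousComponent 1 (X i : MvPolynomial (Fin 2) ℝ) = X i := fun i =>
    homogeneousComponent_eq_self (isHomogeneous_X ℝ i)
  have hC : homogeneousComponent 1 (C (c 2) : MvPolynomial (Fin 2) ℝ) = 0 :=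
    homogeneousComponent_eq_zero _ _ (by simp)
  rw [eval_homogenize, e0, e1, e2]
  simp [sum_range_succ, homogeneousComponent_zero, homogeneousComponent_C_mul, hX, hC,
    linearForm]
  ring

lemma card_filter_linearForm_le {A : Finset (Fin 2 → ℝ)}
    (hline : ∀ B : Finset (Fin 2 → ℝ), B ⊆ A → #B = 4 → ¬ Collinear ℝ (B : Set (Fin 2 → ℝ)))
    {c : Fin 3 → ℝ} (hc : c ≠ 0) : #{a ∈ A | eval a (linearForm c) = 0} ≤ 3 := by
  by_contra! h
  obtain ⟨B, hB, hB4⟩ := exists_subset_card_eq (Nat.succ_le_of_lt h)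
  refine hline B (hB.trans (filter_subset _ _)) hB4 ?_
  have hz : ∀ b ∈ B, c 0 * b 0 + c 1 * b 1 + c 2 = 0 := fun b hb => by
    rw [← eval_linearForm]
    exact (mem_filter.1 (hB hb)).2
  obtain ⟨b₀, hb₀⟩ : B.Nonempty := card_pos.1 (by omega)
  -- A nonzero `c` may define a nonzero constant, but that has no zeros; the zero `b₀` forces a
  -- genuine line.
  have hN : c 0 ^ 2 + c 1 ^ 2 ≠ 0 := by
    intro h0
    have h00 : c 0 = 0 := by nlinarith [sq_nonneg (c 0), sq_nonneg (c 1)]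
    have h01 : c 1 = 0 := by nlinarith [sq_nonneg (c 0), sq_nonneg (c 1)]
    have h02 := hz b₀ hb₀
    rw [h00, h01] at h02
    apply hc
    ext i
    fin_cases i
    · exact h00
    · exact h01
    · simpa using h02
  rw [collinear_iff_of_mem (p₀ := b₀) (by simpa using hb₀)]
  refine ⟨![-c 1, c 0], fun b hb => ?_⟩
  refine ⟨((b 1 - b₀ 1) * c 0 - (b 0 - b₀ 0) * c 1) / (c 0 ^ 2 + c 1 ^ 2), ?_⟩
  have h1 := hz b hb
  have h2 := hz b₀ hb₀
  ext i
  fin_cases i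
  · simp
    field_simp
    linear_combination c 0 * h1 - c 0 * h2
  · simp
    field_simp
    linear_combination c 1 * h1 - c 1 * h2

/-- The vertical and the horizontal line through `a` meet, projectively, only at `(a : 1)`. -/
lemma exists_linearForm_of_not_proportional {u : Fin 3 → ℝ} {a : Fin 2 → ℝ}
    (hu : ∀ t : ℝ, u ≠ t • extendVec a 1) :
    ∃ c : Fin 3 → ℝ, eval a (linearForm c) = 0 ∧ eval u (homogenize 1 (linearForm c)) ≠ 0 := by
  by_contra! H
  apply hu (u 2)
  have h0 := H ![1, 0, -a 0] (by simp [eval_linearForm])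
  have h1 := H ![0, 1, -a 1] (by simp [eval_linearForm])
  rw [eval_homogenize_linearForm] at h0 h1
  simp at h0 h1
  ext i
  refine Fin.lastCases ?_ (fun j => ?_) i
  · rw [Pi.smul_apply, extendVec_last]
    simp [Fin.last]
  · rw [Pi.smul_apply, extendVec_castSucc]
    fin_cases j
    · simp
      linarith
    · simp
      linarith

/-- A product of lines, one through each point of `T` and none through `u`. -/
lemma exists_totalDegree_le_separating {u : Fin 3 → ℝ} (hu : u ≠ 0) (k : ℕ) :
    ∀ T : Finset (Fin 2 → ℝ), #T ≤ k → (∀ a ∈ T, ∀ t : ℝ, u ≠ t • extendVec a 1) →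
      ∃ f : MvPolynomial (Fin 2) ℝ, f.totalDegree ≤ k ∧ (∀ a ∈ T, eval a f = 0) ∧
        eval u (homogenize k f) ≠ 0 := by
  induction k with
  | zero =>
    intro T hT _
    rw [Nat.le_zero, card_eq_zero] at hT
    subst hT
    obtain ⟨x, t, rfl⟩ := exists_eq_extendVec u
    refine ⟨1, by simp, by simp, ?_⟩
    rw [eval_homogenize]
    simp [homogeneousComponent_zero]
  | succ k ih =>
    intro T hT hTu
    rcases T.eq_empty_or_nonempty with rfl | ⟨a, ha⟩
    · obtain ⟨f, hfd, -, hfu⟩ := ih ∅ (by simp) (by simp)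
      -- With no points left, a factor is still needed to keep the degree `k + 1` homogenization
      -- nonzero at `u`, which may lie at infinity: a coordinate form not vanishing at `u`.
      obtain ⟨i, hi⟩ := Function.ne_iff.1 hu
      refine ⟨f * linearForm (Pi.single i 1), (totalDegree_mul _ _).trans
        (add_le_add hfd (totalDegree_linearForm_le _)), by simp, ?_⟩
      rw [eval_homogenize_mul hfd (totalDegree_linearForm_le _), eval_homogenize_linearForm]
      refine mul_ne_zero hfu ?_
      fin_cases i <;> simpa using hi
    · obtain ⟨f, hfd, hfT, hfu⟩ := ih (T.erase a) (by rw [card_erase_of_mem ha]; omega)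
        fun b hb => hTu b (mem_of_mem_erase hb)
      obtain ⟨c, hca, hcu⟩ := exists_linearForm_of_not_proportional (hTu a ha)
      refine ⟨f * linearForm c, (totalDegree_mul _ _).trans
        (add_le_add hfd (totalDegree_linearForm_le _)), fun b hb => ?_, ?_⟩
      · by_cases hba : b = a
        · simp [hba, hca]
        · simp [hfT b (mem_erase.2 ⟨hba, hb⟩)]
      · rw [eval_homogenize_mul hfd (totalDegree_linearForm_le _)]
        exact mul_ne_zero hfu hcu

lemma extendVec_ne_smul {a b : Fin 2 → ℝ} (h : a ≠ b) (t : ℝ) :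
    extendVec a 1 ≠ t • extendVec b 1 := by
  intro H
  have ht : t = 1 := by
    have := congrFun H (Fin.last 2)
    rw [Pi.smul_apply, extendVec_last, extendVec_last] at this
    simpa using this.symm
  apply h
  ext i
  have := congrFun H i.castSucc
  rw [Pi.smul_apply, extendVec_castSucc, extendVec_castSucc] at this
  simpa [ht] using this

lemma extendVec_one_ne_zero (a : Fin 2 → ℝ) : extendVec a 1 ≠ 0 := by
  intro H
  have := congrFun H (Fin.last 2)
  rw [extendVec_last] at this
  simp at this

lemma exists_totalDegree_le_separating_affine {a : Fin 2 → ℝ} {k : ℕ} {T : Finset (Fin 2 → ℝ)}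
    (hT : #T ≤ k) (haT : a ∉ T) :
    ∃ f : MvPolynomial (Fin 2) ℝ, f.totalDegree ≤ k ∧ (∀ b ∈ T, eval b f = 0) ∧
      eval a f ≠ 0 := by
  obtain ⟨f, hfd, hfT, hfa⟩ := exists_totalDegree_le_separating (extendVec_one_ne_zero a) k T hT
    fun b hb => extendVec_ne_smul (fun h => haT (h ▸ hb))
  exact ⟨f, hfd, hfT, by rwa [eval_homogenize_one hfd] at hfa⟩

end LinearForm

/-! ### Conics through all points of `A` but one -/

section Conics

lemma eq_zero_of_vanishing_of_totalDegree_le_two {A : Set (Fin 2 → ℝ)} (hA : A.Nonempty)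
    (hconic : ¬ ∃ q : MvPolynomial (Fin 2) ℝ, q.totalDegree = 2 ∧ ∀ a ∈ A, eval a q = 0)
    {q : MvPolynomial (Fin 2) ℝ} (hq : q.totalDegree ≤ 2) (hqA : ∀ a ∈ A, eval a q = 0) :
    q = 0 := by
  by_contra h0
  obtain h | h | h : q.totalDegree = 0 ∨ q.totalDegree = 1 ∨ q.totalDegree = 2 := by omega
  · rw [totalDegree_eq_zero_iff_eq_C] at h
    obtain ⟨a, ha⟩ := hA
    have := hqA a ha
    rw [h, eval_C] at this
    exact h0 (by rw [h, this, C_0])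
  · refine hconic ⟨q * X 0, ?_, fun a ha => by simp [hqA a ha]⟩
    rw [totalDegree_mul_of_isDomain h0 (X_ne_zero _), h, totalDegree_X]
  -- The hypothesis excludes degree exactly 2, so a line is completed to a reducible conic.
  · exact hconic ⟨q, h, hqA⟩

lemma finrank_conics : Module.finrank ℝ (restrictTotalDegree (Fin 2) ℝ 2) = 6 :=
  (finrank_restrictTotalDegree_two 2).trans (by decide)

lemma finrank_cubics : Module.finrank ℝ (restrictTotalDegree (Fin 2) ℝ 3) = 10 :=
  (finrank_restrictTotalDegree_two 3).trans (by decide)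

lemma finrank_sextics : Module.finrank ℝ (restrictTotalDegree (Fin 2) ℝ 6) = 28 :=
  (finrank_restrictTotalDegree_two 6).trans (by decide)

/-- No conic passes through all points of `A` except possibly `p`. -/
def NoConicOffPoint (A : Finset (Fin 2 → ℝ)) (p : Fin 2 → ℝ) : Prop :=
  ∀ q : MvPolynomial (Fin 2) ℝ, q.totalDegree ≤ 2 → (∀ a ∈ A, a ≠ p → eval a q = 0) → q = 0

/-- As 6 < 7, a nonzero functional `φ` kills all value vectors of conics on `A`. At a point `p`
where `φ` has a nonzero coefficient, this relation determines the value of a conic from its values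
at the other points. -/
lemma exists_noConicOffPoint {A : Finset (Fin 2 → ℝ)} (hcard : #A = 7)
    (hC : ∀ q : MvPolynomial (Fin 2) ℝ, q.totalDegree ≤ 2 → (∀ a ∈ A, eval a q = 0) → q = 0) :
    ∃ p ∈ A, NoConicOffPoint A p := by
  have hlt : LinearMap.range (evalOn 2 A) < ⊤ := by
    rw [lt_top_iff_ne_top]
    intro h
    have h1 := LinearMap.finrank_range_add_finrank_ker (evalOn 2 A)
    rw [h, finrank_top, finrank_conics, Module.finrank_pi, Fintype.card_coe, hcard] at h1
    omega
  obtain ⟨φ, hφ, hker⟩ := Submodule.exists_le_ker_of_lt_top _ hlt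
  obtain ⟨p, hp⟩ : ∃ p : A, φ (Pi.single p 1) ≠ 0 := by
    by_contra! H
    exact hφ (LinearMap.pi_ext' fun p => LinearMap.ext_ring (by simpa using H p))
  refine ⟨p, p.2, fun q hq hqA => hC q hq fun a ha => ?_⟩
  let q' : restrictTotalDegree (Fin 2) ℝ 2 := ⟨q, (mem_restrictTotalDegree _ _ _).2 hq⟩
  have hev : evalOn 2 A q' = eval (p : Fin 2 → ℝ) q • Pi.single p (1 : ℝ) := by
    ext b
    rw [evalOn_apply, Pi.smul_apply]
    by_cases hb : b = p
    · subst hb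
      simp [q']
    · rw [Pi.single_eq_of_ne hb, smul_zero]
      exact hqA b b.2 fun h => hb (Subtype.ext h)
  have h0 : φ (evalOn 2 A q') = 0 := hker ⟨q', rfl⟩
  rw [hev, map_smul, smul_eq_mul] at h0
  by_cases hap : a = p
  · rw [hap]
    exact (mul_eq_zero.1 h0).resolve_right hp
  · exact hqA a ha hap

lemma NoConicOffPoint.exists_interpolation {A : Finset (Fin 2 → ℝ)} {p : Fin 2 → ℝ}
    (hcard : #A = 7) (hpA : p ∈ A) (hp : NoConicOffPoint A p) (y : (Fin 2 → ℝ) → ℝ) :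
    ∃ q : MvPolynomial (Fin 2) ℝ, q.totalDegree ≤ 2 ∧ ∀ a ∈ A, a ≠ p → eval a q = y a := by
  have hinj : Function.Injective (evalOn 2 (A.erase p)) := by
    rw [← LinearMap.ker_eq_bot, LinearMap.ker_eq_bot']
    intro q hq
    refine Subtype.ext (hp _ ((mem_restrictTotalDegree _ _ _).1 q.2) fun a ha hap => ?_)
    rw [← evalOn_apply 2 (A.erase p) q ⟨a, mem_erase.2 ⟨hap, ha⟩⟩, hq]
    rfl
  have hsurj := (LinearMap.injective_iff_surjective_of_finrank_eq_finrank (by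
    rw [finrank_conics, Module.finrank_pi, Fintype.card_coe, card_erase_of_mem hpA, hcard])).1 hinj
  obtain ⟨q, hq⟩ := hsurj fun b => y b
  refine ⟨q, (mem_restrictTotalDegree _ _ _).1 q.2, fun a ha hap => ?_⟩
  rw [← evalOn_apply 2 (A.erase p) q ⟨a, mem_erase.2 ⟨hap, ha⟩⟩, hq]

/-- The central correction: `q` interpolates `f / m`. Its value at `p` is not prescribed, which is
harmless because `m` vanishes there. -/
lemma NoConicOffPoint.exists_sub_mul {A : Finset (Fin 2 → ℝ)} {p : Fin 2 → ℝ}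
    (hcard : #A = 7) (hpA : p ∈ A) (hp : NoConicOffPoint A p) {m f : MvPolynomial (Fin 2) ℝ}
    (hm : m.totalDegree ≤ 1) (hmp : eval p m = 0) (hf : f.totalDegree ≤ 3) :
    ∃ q : MvPolynomial (Fin 2) ℝ, q.totalDegree ≤ 2 ∧ (f - m * q).totalDegree ≤ 3 ∧
      ∀ a ∈ A, eval a m ≠ 0 → eval a (f - m * q) = 0 := by
  obtain ⟨q, hq, hqA⟩ := hp.exists_interpolation hcard hpA fun a => eval a f / eval a m
  have hmq : (m * q).totalDegree ≤ 3 := (totalDegree_mul _ _).trans (add_le_add hm hq)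
  refine ⟨q, hq, (totalDegree_sub _ _).trans (max_le hf hmq), fun a ha ham => ?_⟩
  have hap : a ≠ p := fun h => ham (h ▸ hmp)
  rw [map_sub, map_mul, hqA a ha hap]
  field_simp
  ring

end Conics

/-! ### Cubics through `A`: dimension, forced zeros, fullness -/

section Cubics

variable {A : Finset (Fin 2 → ℝ)}

lemma NoConicOffPoint.exists_cubic_eval_ne_zero (hcard : #A = 7)
    (hline : ∀ B : Finset (Fin 2 → ℝ), B ⊆ A → #B = 4 → ¬ Collinear ℝ (B : Set (Fin 2 → ℝ)))
    {p : Fin 2 → ℝ} (hpA : p ∈ A) (hp : NoConicOffPoint A p) :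
    ∃ f : MvPolynomial (Fin 2) ℝ, f.totalDegree ≤ 3 ∧ (∀ a ∈ A, a ≠ p → eval a f = 0) ∧
      eval p f ≠ 0 := by
  -- The vertical line through `p`; any other line through `p` would serve.
  set c : Fin 3 → ℝ := ![1, 0, -p 0]
  have hc : c ≠ 0 := Function.ne_iff.2 ⟨0, by simp [c]⟩
  have hcp : eval p (linearForm c) = 0 := by simp [eval_linearForm, c]
  obtain ⟨f, hfd, hfT, hfp⟩ := exists_totalDegree_le_separating_affine (k := 3)
    (T := {a ∈ A | eval a (linearForm c) = 0}.erase p)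
    ((card_erase_le).trans (card_filter_linearForm_le hline hc)) (notMem_erase _ _)
  obtain ⟨q, hq, hd, hqA⟩ := hp.exists_sub_mul hcard hpA (totalDegree_linearForm_le c) hcp hfd
  refine ⟨f - linearForm c * q, hd, fun a ha hap => ?_, by simpa [hcp] using hfp⟩
  by_cases h : eval a (linearForm c) = 0
  · simp [h, hfT a (mem_erase.2 ⟨hap, mem_filter.2 ⟨ha, h⟩⟩)]
  · exact hqA a ha h

lemma NoConicOffPoint.finrank_vanishingSpace (hcard : #A = 7)
    (hline : ∀ B : Finset (Fin 2 → ℝ), B ⊆ A → #B = 4 → ¬ Collinear ℝ (B : Set (Fin 2 → ℝ)))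
    {p : Fin 2 → ℝ} (hpA : p ∈ A) (hp : NoConicOffPoint A p) :
    Module.finrank ℝ (vanishingSpace 3 (A : Set (Fin 2 → ℝ))) = 3 := by
  have hsurj : LinearMap.range (evalOn 3 A) = ⊤ := by
    rw [LinearMap.range_eq_top]
    intro y
    obtain ⟨q, hq, hqA⟩ := hp.exists_interpolation hcard hpA
      fun a => if h : a ∈ A then y ⟨a, h⟩ else 0
    obtain ⟨f, hfd, hfA, hfp⟩ := hp.exists_cubic_eval_ne_zero hcard hline hpA
    set r : ℝ := (y ⟨p, hpA⟩ - eval p q) / eval p f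
    refine ⟨⟨q + r • f, (mem_restrictTotalDegree _ _ _).2 ((totalDegree_add _ _).trans
      (max_le (hq.trans (by norm_num)) ((totalDegree_smul_le _ _).trans hfd)))⟩, ?_⟩
    ext ⟨a, ha⟩
    rw [evalOn_apply]
    by_cases hap : a = p
    · subst hap
      simp only [map_add, smul_eval, r]
      field_simp
      ring
    · simp [smul_eval, hfA a ha hap, hqA a ha hap, ha]
  have h1 := LinearMap.finrank_range_add_finrank_ker (evalOn 3 A)
  rw [hsurj, finrank_top, finrank_cubics, Module.finrank_pi, Fintype.card_coe, hcard] at h1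
  rw [finrank_vanishingSpace_eq]
  omega

lemma NoConicOffPoint.projForcedZeros_eq_empty (hcard : #A = 7)
    (hline : ∀ B : Finset (Fin 2 → ℝ), B ⊆ A → #B = 4 → ¬ Collinear ℝ (B : Set (Fin 2 → ℝ)))
    {p : Fin 2 → ℝ} (hpA : p ∈ A) (hp : NoConicOffPoint A p) :
    projForcedZeros 3 (A : Set (Fin 2 → ℝ)) = ∅ := by
  rw [Set.eq_empty_iff_forall_notMem]
  rintro u ⟨hu0, huV, huA⟩
  -- The cross product of `u` and `(p, 1)`: the line joining the two points, well defined since they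
  -- are not proportional.
  set c : Fin 3 → ℝ := ![u 1 - u 2 * p 1, u 2 * p 0 - u 0, u 0 * p 1 - u 1 * p 0]
  have hc : c ≠ 0 := by
    intro h
    have h0 : u 1 - u 2 * p 1 = 0 := congrFun h 0
    have h1 : u 2 * p 0 - u 0 = 0 := congrFun h 1
    apply huA p hpA (u 2)
    ext i
    refine Fin.lastCases ?_ (fun j => ?_) i
    · rw [Pi.smul_apply, extendVec_last]
      simp [Fin.last]
    · rw [Pi.smul_apply, extendVec_castSucc]
      fin_cases j
      · simp
        linarith
      · simp
        linarith
  have hcp : eval p (linearForm c) = 0 := by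
    simp [eval_linearForm, c]
    ring
  have hcu : eval u (homogenize 1 (linearForm c)) = 0 := by
    simp [eval_homogenize_linearForm, c]
    ring
  obtain ⟨f, hfd, hfT, hfu⟩ := exists_totalDegree_le_separating hu0 3
    {a ∈ A | eval a (linearForm c) = 0} (card_filter_linearForm_le hline hc)
    fun a ha => huA a (mem_filter.1 ha).1
  obtain ⟨q, hq, hd, hqA⟩ := hp.exists_sub_mul hcard hpA (totalDegree_linearForm_le c) hcp hfd
  have h := huV (f - linearForm c * q) ⟨hd, fun a ha => by
    by_cases h : eval a (linearForm c) = 0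
    · simp [h, hfT a (mem_filter.2 ⟨ha, h⟩)]
    · exact hqA a ha h⟩
  -- The line passes through `u`, so the correction leaves the nonzero value at `u` intact,
  -- contradicting that `u` is a forced zero.
  rw [homogenize_sub, map_sub, eval_homogenize_mul (d := 1) (e := 2)
    (totalDegree_linearForm_le c) hq, hcu, zero_mul, sub_zero] at h
  exact hfu h

lemma NoConicOffPoint.exists_directional_ne_zero (hcard : #A = 7)
    (hline : ∀ B : Finset (Fin 2 → ℝ), B ⊆ A → #B = 4 → ¬ Collinear ℝ (B : Set (Fin 2 → ℝ)))
    {a : Fin 2 → ℝ} (haA : a ∈ A) (ha : NoConicOffPoint A a) {w : Fin 2 → ℝ} (hw : w ≠ 0) :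
    ∃ f ∈ vanishingSpace 3 (A : Set (Fin 2 → ℝ)),
      w 0 * eval a (pderiv 0 f) + w 1 * eval a (pderiv 1 f) ≠ 0 := by
  have hww : w 0 * w 0 + w 1 * w 1 ≠ 0 := by
    intro h0
    apply hw
    have h00 : w 0 = 0 := by nlinarith [mul_self_nonneg (w 0), mul_self_nonneg (w 1)]
    have h01 : w 1 = 0 := by nlinarith [mul_self_nonneg (w 0), mul_self_nonneg (w 1)]
    ext i
    fin_cases i
    · exact h00
    · exact h01
  -- `c` is the line through `a` in direction `w`, and `l` its perpendicular at `a`. Along `w` the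
  -- derivative of `l * f` at `a` is `|w|² f(a)`, while that of `c * q` is zero; `f` handles the at
  -- most two other points of `A` on `c`.
  set c : Fin 3 → ℝ := ![w 1, -w 0, w 0 * a 1 - w 1 * a 0]
  set l : Fin 3 → ℝ := ![w 0, w 1, -(w 0 * a 0 + w 1 * a 1)]
  have hc : c ≠ 0 := by
    intro h
    have h0 : w 1 = 0 := congrFun h 0
    have h1 : -w 0 = 0 := congrFun h 1
    apply hww
    rw [h0, neg_eq_zero.1 h1]
    ring
  have hca : eval a (linearForm c) = 0 := by
    simp [eval_linearForm, c]
    ring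
  have hla : eval a (linearForm l) = 0 := by
    simp [eval_linearForm, l]
  obtain ⟨f, hfd, hfT, hfa⟩ := exists_totalDegree_le_separating_affine (k := 2)
    (T := {b ∈ A | eval b (linearForm c) = 0}.erase a) (by
      rw [card_erase_of_mem (mem_filter.2 ⟨haA, hca⟩)]
      exact Nat.sub_le_sub_right (card_filter_linearForm_le hline hc) 1) (notMem_erase _ _)
  have hlf : (linearForm l * f).totalDegree ≤ 3 :=
    (totalDegree_mul _ _).trans (add_le_add (totalDegree_linearForm_le l) hfd)
  obtain ⟨q, hq, hd, hqA⟩ := ha.exists_sub_mul hcard haA (totalDegree_linearForm_le c) hca hlf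
  refine ⟨linearForm l * f - linearForm c * q, ⟨hd, fun b hb => ?_⟩, ?_⟩
  · by_cases h : eval b (linearForm c) = 0
    · by_cases hba : b = a
      · simp [hba, hca, hla]
      · simp [h, hfT b (mem_erase.2 ⟨hba, mem_filter.2 ⟨hb, h⟩⟩)]
    · exact hqA b hb h
  · have : w 0 * eval a (pderiv 0 (linearForm l * f - linearForm c * q)) +
        w 1 * eval a (pderiv 1 (linearForm l * f - linearForm c * q)) =
        (w 0 * w 0 + w 1 * w 1) * eval a f := by
      simp only [map_sub, Derivation.leibniz, map_add, smul_eq_mul, map_mul, hca, hla,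
        eval_pderiv_linearForm_zero, eval_pderiv_linearForm_one]
      simp [c, l]
      ring
    rw [this]
    exact mul_ne_zero hww hfa

/-- Duality: a proper subspace of gradients would be annihilated by some nonzero direction `w`. -/
lemma exists_mem_vanishingSpace_gradient {a : Fin 2 → ℝ}
    (h : ∀ w : Fin 2 → ℝ, w ≠ 0 → ∃ f ∈ vanishingSpace 3 (A : Set (Fin 2 → ℝ)),
      w 0 * eval a (pderiv 0 f) + w 1 * eval a (pderiv 1 f) ≠ 0) (v : Fin 2 → ℝ) :
    ∃ f ∈ vanishingSpace 3 (A : Set (Fin 2 → ℝ)), ∀ i, eval a (pderiv i f) = v i := by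
  let G : vanishingSpace 3 (A : Set (Fin 2 → ℝ)) →ₗ[ℝ] (Fin 2 → ℝ) :=
    (LinearMap.pi fun i => (aeval a).toLinearMap ∘ₗ (pderiv i).toLinearMap) ∘ₗ
      Submodule.subtype _
  have hG : ∀ f i, G f i = eval a (pderiv i (f : MvPolynomial (Fin 2) ℝ)) := by
    intro f i
    simp [G, aeval_eq_eval]
  have hsurj : LinearMap.range G = ⊤ := by
    by_contra hne
    obtain ⟨φ, hφ, hker⟩ := Submodule.exists_le_ker_of_lt_top _ (lt_top_iff_ne_top.2 hne)
    have hφe : ∀ y : Fin 2 → ℝ, φ y = φ (Pi.single 0 1) * y 0 + φ (Pi.single 1 1) * y 1 := by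
      intro y
      have hy : y = y 0 • Pi.single 0 1 + y 1 • Pi.single 1 1 := by
        ext j
        fin_cases j <;> simp
      conv_lhs => rw [hy]
      rw [map_add, map_smul, map_smul, smul_eq_mul, smul_eq_mul, mul_comm, mul_comm (y 1)]
    obtain ⟨f, hf, hf0⟩ := h ![φ (Pi.single 0 1), φ (Pi.single 1 1)] (by
      intro h0
      refine hφ (LinearMap.ext fun y => ?_)
      have h1 : φ (Pi.single 0 1) = 0 := congrFun h0 0
      have h2 : φ (Pi.single 1 1) = 0 := congrFun h0 1
      rw [hφe, h1, h2]
      simp)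
    apply hf0
    have := hker ⟨⟨f, hf⟩, rfl⟩
    rw [LinearMap.mem_ker, hφe, hG, hG] at this
    simpa using this
  obtain ⟨f, hf⟩ := LinearMap.range_eq_top.1 hsurj v
  exact ⟨f, f.2, fun i => by rw [← hG, hf]⟩

lemma isFull_three (hcard : #A = 7)
    (hline : ∀ B : Finset (Fin 2 → ℝ), B ⊆ A → #B = 4 → ¬ Collinear ℝ (B : Set (Fin 2 → ℝ)))
    (hC : ∀ q : MvPolynomial (Fin 2) ℝ, q.totalDegree ≤ 2 → (∀ a ∈ A, eval a q = 0) → q = 0) :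
    IsFull 3 (A : Set (Fin 2 → ℝ)) := by
  intro a ha v
  by_cases hn : NoConicOffPoint A a
  · exact exists_mem_vanishingSpace_gradient
      (fun w hw => hn.exists_directional_ne_zero hcard hline ha hw) v
  -- Here some conic passes through the other six points but not through `a`; multiplying it by a
  -- line through `a` with gradient proportional to `v` gives the required cubic.
  · simp only [NoConicOffPoint, not_forall] at hn
    obtain ⟨q, hq, hqA, hq0⟩ := hn
    have hqa : eval a q ≠ 0 := fun h => hq0 (hC q hq fun b hb => by
      by_cases hba : b = a
      · rw [hba, h]
      · exact hqA b hb hba)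
    set l : Fin 3 → ℝ := ![v 0, v 1, -(v 0 * a 0 + v 1 * a 1)]
    have hla : eval a (linearForm l) = 0 := by
      simp [eval_linearForm, l]
    have hl0 : l 0 = v 0 := rfl
    have hl1 : l 1 = v 1 := rfl
    refine ⟨(eval a q)⁻¹ • (linearForm l * q), Submodule.smul_mem _ _
      ⟨(totalDegree_mul _ _).trans (add_le_add (totalDegree_linearForm_le l) hq),
        fun b hb => ?_⟩, fun i => ?_⟩
    · by_cases hba : b = a
      · simp [hba, hla]
      · simp [hqA b hb hba]
    · fin_cases i
      · simp [smul_eval, hla, eval_pderiv_linearForm_zero, hl0]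
        field_simp
      · simp [smul_eval, hla, eval_pderiv_linearForm_one, hl1]
        field_simp

end Cubics

end HilbertMethod

namespace HilbertMethod

open MvPolynomial Finset

/-! ### First order Taylor expansion -/

section Taylor

open Filter Topology Asymptotics

variable {n : ℕ}

lemma isBigO_coord_sub (a : Fin n → ℝ) (i : Fin n) :
    (fun y : Fin n → ℝ => y i - a i) =O[𝓝 a] fun y => ‖y - a‖ :=
  IsBigO.of_bound 1 (Eventually.of_forall fun y => by
    simpa using norm_le_pi_norm (y - a) i)

/-- In the induction, the remainder of `p * X j` is the remainder of `p` times `y j` plus the linear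
part of `p` times `y j - a j`. -/
lemma isBigO_taylor_one (a : Fin n → ℝ) (p : MvPolynomial (Fin n) ℝ) :
    (fun y => eval y p - eval a p - ∑ i, eval a (pderiv i p) * (y i - a i)) =O[𝓝 a]
      fun y => ‖y - a‖ ^ 2 := by
  induction p using MvPolynomial.induction_on with
  | C r => simpa using isBigO_zero _ _
  | add p q hp hq =>
    refine (hp.add hq).congr_left fun y => ?_
    simp only [map_add, add_mul, sum_add_distrib]
    ring
  | mul_X p j hp =>
    have hcont : (fun y : Fin n → ℝ => y j) =O[𝓝 a] fun _ => (1 : ℝ) :=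
      ((continuous_apply j).tendsto a).isBigO_one ℝ
    have h1 : (fun y => (eval y p - eval a p - ∑ i, eval a (pderiv i p) * (y i - a i)) * y j)
        =O[𝓝 a] fun y => ‖y - a‖ ^ 2 := by
      simpa using hp.mul hcont
    have h2 : (fun y : Fin n → ℝ => (∑ i, eval a (pderiv i p) * (y i - a i)) * (y j - a j))
        =O[𝓝 a] fun y => ‖y - a‖ ^ 2 := by
      have hs : (fun y : Fin n → ℝ => ∑ i, eval a (pderiv i p) * (y i - a i)) =O[𝓝 a]
          fun y => ‖y - a‖ :=
        IsBigO.fun_sum fun i _ => (isBigO_coord_sub a i).const_mul_left _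
      simpa only [sq] using hs.mul (isBigO_coord_sub a j)
    refine (h1.add h2).congr_left fun y => ?_
    have hX : ∑ i, eval a p * (if j = i then 1 else 0) * (y i - a i) =
        eval a p * (y j - a j) := by
      simp
    have hd : ∀ i, eval a (pderiv i (p * X j)) * (y i - a i) =
        eval a p * (if j = i then 1 else 0) * (y i - a i) +
          eval a (pderiv i p) * (y i - a i) * a j := by
      intro i
      rw [Derivation.leibniz, pderiv_X]
      by_cases h : j = i
      · subst h
        simp
        ring
      · simp [h]
        ring
    simp only [hd, sum_add_distrib, hX, ← sum_mul, map_mul, eval_X]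
    ring

end Taylor

/-! ### The sum of squares of a basis -/

section SumSqBasis

variable {n d s : ℕ} {A : Set (Fin n → ℝ)} (f : Module.Basis (Fin s) ℝ (vanishingSpace d A))

lemma totalDegree_sumSqBasis_le : (sumSqBasis f).totalDegree ≤ 2 * d := by
  refine totalDegree_finsetSum_le fun j _ => (totalDegree_pow _ _).trans ?_
  exact Nat.mul_le_mul_left 2 (f j).2.1

lemma eval_sumSqBasis (x : Fin n → ℝ) :
    eval x (sumSqBasis f) = ∑ j, eval x (f j : MvPolynomial (Fin n) ℝ) ^ 2 := by
  simp [sumSqBasis]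

lemma eval_homogenize_sumSqBasis (u : Fin (n + 1) → ℝ) :
    eval u (homogenize (2 * d) (sumSqBasis f)) =
      ∑ j, eval u (homogenize d (f j : MvPolynomial (Fin n) ℝ)) ^ 2 := by
  rw [sumSqBasis, homogenize_sum, map_sum]
  refine sum_congr rfl fun j _ => ?_
  rw [sq, sq, two_mul, eval_homogenize_mul (f j).2.1 (f j).2.1]

lemma coe_eq_sum_repr (p : vanishingSpace d A) :
    (p : MvPolynomial (Fin n) ℝ) = ∑ j, f.repr p j • (f j : MvPolynomial (Fin n) ℝ) := by
  have h := congrArg (Submodule.subtype _) (f.sum_repr p)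
  rw [map_sum] at h
  exact h.symm

lemma eval_homogenize_sumSqBasis_nonneg (u : Fin (n + 1) → ℝ) :
    0 ≤ eval u (homogenize (2 * d) (sumSqBasis f)) := by
  rw [eval_homogenize_sumSqBasis]
  positivity

lemma eval_homogenize_eq_zero_of_sumSqBasis {u : Fin (n + 1) → ℝ}
    (hu : eval u (homogenize (2 * d) (sumSqBasis f)) = 0) :
    ∀ p ∈ vanishingSpace d A, eval u (homogenize d p) = 0 := by
  intro p hp
  rw [eval_homogenize_sumSqBasis, sum_eq_zero_iff_of_nonneg fun _ _ => sq_nonneg _] at hu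
  have h := coe_eq_sum_repr f ⟨p, hp⟩
  simp only at h
  rw [h, homogenize_sum, map_sum]
  refine sum_eq_zero fun j hj => ?_
  rw [homogenize_smul, smul_eval, pow_eq_zero_iff two_ne_zero |>.1 (hu j hj), mul_zero]

/-- Cauchy–Schwarz applied to the coordinates of `p` in the basis. -/
lemma exists_sq_le_mul_sumSqBasis {p : MvPolynomial (Fin n) ℝ} (hp : p ∈ vanishingSpace d A) :
    ∃ K : ℝ, ∀ x, eval x p ^ 2 ≤ K * eval x (sumSqBasis f) := by
  refine ⟨∑ j, f.repr ⟨p, hp⟩ j ^ 2, fun x => ?_⟩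
  have h := coe_eq_sum_repr f ⟨p, hp⟩
  simp only at h
  have hx : eval x p = ∑ j, f.repr ⟨p, hp⟩ j * eval x (f j : MvPolynomial (Fin n) ℝ) := by
    conv_lhs => rw [h]
    simp [smul_eval]
  rw [hx, eval_sumSqBasis]
  exact sum_mul_sq_le_sq_mul_sq _ _ _

lemma eval_sumSqBasis_nonneg (x : Fin n → ℝ) : 0 ≤ eval x (sumSqBasis f) := by
  rw [eval_sumSqBasis]
  positivity

lemma eval_sumSqBasis_eq_zero {a : Fin n → ℝ} (ha : a ∈ A) : eval a (sumSqBasis f) = 0 := by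
  rw [eval_sumSqBasis]
  exact sum_eq_zero fun j _ => by rw [(f j).2.2 a ha, zero_pow two_ne_zero]

lemma sumSqBasis_mem_vanishingSpaceSq : sumSqBasis f ∈ vanishingSpaceSq d A :=
  sum_mem fun j _ => by
    rw [sq]
    exact Submodule.mul_mem_mul (f j).2 (f j).2

end SumSqBasis

/-! ### Domination of `g` by the sum of squares -/

section Domination

open Filter Topology Asymptotics

variable {n d s : ℕ} {A : Set (Fin n → ℝ)} (f : Module.Basis (Fin s) ℝ (vanishingSpace d A))

/-- Fullness gives members `F i` with gradient the `i`-th unit vector, so they approximate the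
coordinates of `y - a`, while their squares are bounded by multiples of the sum of squares. -/
lemma isBigO_norm_sub_sq_sumSqBasis (hfull : IsFull d A) {a : Fin n → ℝ} (ha : a ∈ A) :
    (fun y => ‖y - a‖ ^ 2) =O[𝓝 a] fun y => eval y (sumSqBasis f) := by
  choose F hFV hFg using fun i : Fin n => hfull a ha (Pi.single i 1)
  choose K hK using fun i => exists_sq_le_mul_sumSqBasis f (hFV i)
  have hsmall : ∀ i, ∀ᶠ y in 𝓝 a, |eval y (F i) - (y i - a i)| ≤ 1 / 2 * ‖y - a‖ := by
    intro i
    have h1 : (fun y => eval y (F i) - (y i - a i)) =O[𝓝 a] fun y => ‖y - a‖ ^ 2 := by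
      refine (isBigO_taylor_one a (F i)).congr_left fun y => ?_
      simp [(hFV i).2 a ha, hFg, Pi.single_apply]
    have h2 : (fun y : Fin n → ℝ => ‖y - a‖ ^ 2) =o[𝓝 a] fun y => ‖y - a‖ := by
      have h3 : Tendsto (fun y : Fin n → ℝ => ‖y - a‖) (𝓝 a) (𝓝 0) := by
        have : Continuous fun y : Fin n → ℝ => ‖y - a‖ := by fun_prop
        simpa using this.tendsto a
      simpa [sq] using ((isLittleO_one_iff ℝ).2 h3).mul_isBigO
        (isBigO_refl (fun y : Fin n → ℝ => ‖y - a‖) (𝓝 a))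
    have h3 := (h1.trans_isLittleO h2).bound (c := 1 / 2) (by norm_num)
    simpa using h3
  -- The factor 4 is the square of the 2 gained by absorbing the error `1 / 2 * ‖y - a‖` on the
  -- left.
  refine IsBigO.of_bound (4 * ∑ i, |K i|) ?_
  filter_upwards [eventually_all.2 hsmall] with y hy
  have hS := eval_sumSqBasis_nonneg f y
  set S := eval y (sumSqBasis f)
  have hsum : (0 : ℝ) ≤ ∑ i, |K i| := sum_nonneg fun _ _ => abs_nonneg _
  have hF : ∀ i, |eval y (F i)| ≤ √((∑ i, |K i|) * S) := by
    intro i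
    apply Real.abs_le_sqrt
    refine (hK i y).trans (mul_le_mul_of_nonneg_right ?_ hS)
    exact (le_abs_self _).trans (single_le_sum (f := fun i => |K i|)
      (fun _ _ => abs_nonneg _) (mem_univ i))
  have hr : ‖y - a‖ ≤ √((∑ i, |K i|) * S) + 1 / 2 * ‖y - a‖ := by
    rw [pi_norm_le_iff_of_nonneg (by positivity)]
    intro i
    rw [Pi.sub_apply, Real.norm_eq_abs]
    have h := abs_sub_abs_le_abs_sub (y i - a i) (eval y (F i))
    rw [abs_sub_comm (y i - a i)] at h
    linarith [hy i, hF i]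
  have hr' : ‖y - a‖ ≤ 2 * √((∑ i, |K i|) * S) := by linarith
  rw [Real.norm_of_nonneg (by positivity), Real.norm_of_nonneg hS]
  calc ‖y - a‖ ^ 2 ≤ (2 * √((∑ i, |K i|) * S)) ^ 2 := by gcongr
    _ = 4 * (∑ i, |K i|) * S := by
      rw [mul_pow, Real.sq_sqrt (mul_nonneg hsum hS)]
      ring

lemma isBigO_sumSqBasis_of_mem_singularSpace (hfull : IsFull d A) {g : MvPolynomial (Fin n) ℝ}
    {e : ℕ} (hg : g ∈ singularSpace e A) {a : Fin n → ℝ} (ha : a ∈ A) :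
    (fun y => eval y g) =O[𝓝 a] fun y => eval y (sumSqBasis f) := by
  refine IsBigO.trans ?_ (isBigO_norm_sub_sq_sumSqBasis f hfull ha)
  refine (isBigO_taylor_one a g).congr_left fun y => ?_
  simp [(hg.2 a ha).1, (hg.2 a ha).2]

lemma exists_abs_homogenize_le_nhds (hfull : IsFull d A) (hforced : projForcedZeros d A = ∅)
    {g : MvPolynomial (Fin n) ℝ} (hg : g ∈ singularSpace (2 * d) A) {u : Fin (n + 1) → ℝ}
    (hu : u ≠ 0) :
    ∃ K : ℝ, ∀ᶠ v in 𝓝 u, |eval v (homogenize (2 * d) g)| ≤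
      K * eval v (homogenize (2 * d) (sumSqBasis f)) := by
  by_cases hS : eval u (homogenize (2 * d) (sumSqBasis f)) = 0
  -- Without forced zeros, a zero of the homogenized sum represents a point of `A`; the affine
  -- estimate is transported there through the chart. The even degree makes the scaling factor
  -- nonnegative for either sign of the last coordinate.
  · obtain ⟨a, ha, t, hat⟩ : ∃ a ∈ A, ∃ t : ℝ, u = t • extendVec a 1 := by
      by_contra! H
      exact Set.notMem_empty u
        (hforced ▸ ⟨hu, eval_homogenize_eq_zero_of_sumSqBasis f hS, H⟩)
    have ht : t ≠ 0 := fun h => hu (by rw [hat, h, zero_smul])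
    have hlast : u (Fin.last n) = t := by
      rw [hat, Pi.smul_apply, extendVec_last, smul_eq_mul, mul_one]
    have hinit : (fun i : Fin n => (u (Fin.last n))⁻¹ * u i.castSucc) = a := by
      ext i
      rw [hlast, hat, Pi.smul_apply, extendVec_castSucc, smul_eq_mul]
      field_simp
    obtain ⟨K, hK⟩ := (isBigO_sumSqBasis_of_mem_singularSpace f hfull hg ha).bound
    have hne : u (Fin.last n) ≠ 0 := by rwa [hlast]
    have htend : Tendsto (fun (v : Fin (n + 1) → ℝ) (i : Fin n) =>
        (v (Fin.last n))⁻¹ * v i.castSucc) (𝓝 u) (𝓝 a) := by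
      rw [← hinit, tendsto_pi_nhds]
      intro i
      exact ((continuous_apply (Fin.last n)).tendsto u).inv₀ hne |>.mul
        ((continuous_apply i.castSucc).tendsto u)
    refine ⟨K, ?_⟩
    filter_upwards [htend.eventually hK,
      (continuous_apply (Fin.last n)).continuousAt.eventually_ne hne] with v hv hv0
    obtain ⟨x, r, rfl⟩ := exists_eq_extendVec v
    simp only [extendVec_last, extendVec_castSucc] at hv hv0
    have hx : (fun i => r⁻¹ * x i) = r⁻¹ • x := rfl
    rw [hx, Real.norm_eq_abs, Real.norm_of_nonneg (eval_sumSqBasis_nonneg f _)] at hv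
    rw [eval_homogenize_of_ne_zero hg.1 x hv0,
      eval_homogenize_of_ne_zero (totalDegree_sumSqBasis_le f) x hv0, abs_mul, pow_mul,
      abs_of_nonneg (by positivity : (0 : ℝ) ≤ (r ^ 2) ^ d)]
    calc (r ^ 2) ^ d * |eval (r⁻¹ • x) g|
        ≤ (r ^ 2) ^ d * (K * eval (r⁻¹ • x) (sumSqBasis f)) := by gcongr
      _ = K * ((r ^ 2) ^ d * eval (r⁻¹ • x) (sumSqBasis f)) := by ring
  · have hSpos := lt_of_le_of_ne (eval_homogenize_sumSqBasis_nonneg f u) (Ne.symm hS)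
    set S₀ := eval u (homogenize (2 * d) (sumSqBasis f))
    set g₀ := |eval u (homogenize (2 * d) g)|
    have h1 : ∀ᶠ v in 𝓝 u, S₀ / 2 < eval v (homogenize (2 * d) (sumSqBasis f)) :=
      (continuous_eval _).continuousAt.eventually_const_lt (half_lt_self hSpos)
    have h2 : ∀ᶠ v in 𝓝 u, |eval v (homogenize (2 * d) g)| < g₀ + 1 :=
      (continuous_eval _).abs.continuousAt.eventually_lt_const (lt_add_one g₀)
    refine ⟨(g₀ + 1) / (S₀ / 2), ?_⟩
    filter_upwards [h1, h2] with v hv1 hv2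
    have hg0 : 0 ≤ g₀ := abs_nonneg _
    rw [div_mul_eq_mul_div, le_div_iff₀ (by positivity)]
    exact mul_le_mul hv2.le hv1.le (by positivity) (by positivity)

lemma exists_abs_homogenize_le (hfull : IsFull d A) (hforced : projForcedZeros d A = ∅)
    {g : MvPolynomial (Fin n) ℝ} (hg : g ∈ singularSpace (2 * d) A) :
    ∃ K : ℝ, 0 < K ∧ ∀ u : Fin (n + 1) → ℝ, u ≠ 0 →
      |eval u (homogenize (2 * d) g)| ≤ K * eval u (homogenize (2 * d) (sumSqBasis f)) := by
  obtain ⟨K, hK⟩ : ∃ K : ℝ, ∀ v ∈ Metric.sphere (0 : Fin (n + 1) → ℝ) 1,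
      |eval v (homogenize (2 * d) g)| ≤ K * eval v (homogenize (2 * d) (sumSqBasis f)) := by
    refine (isCompact_sphere (0 : Fin (n + 1) → ℝ) 1).induction_on
      (p := fun T => ∃ K : ℝ, ∀ v ∈ T, |eval v (homogenize (2 * d) g)| ≤
        K * eval v (homogenize (2 * d) (sumSqBasis f))) ?_ ?_ ?_ ?_
    · exact ⟨0, fun _ h => h.elim⟩
    · rintro T T' hTT' ⟨K, hK⟩
      exact ⟨K, fun v hv => hK v (hTT' hv)⟩
    · rintro T T' ⟨K, hK⟩ ⟨K', hK'⟩
      refine ⟨max K K', fun v hv => ?_⟩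
      have hS := eval_homogenize_sumSqBasis_nonneg f v
      rcases hv with hv | hv
      · exact (hK v hv).trans (mul_le_mul_of_nonneg_right (le_max_left _ _) hS)
      · exact (hK' v hv).trans (mul_le_mul_of_nonneg_right (le_max_right _ _) hS)
    · intro u hu
      obtain ⟨K, hK⟩ := exists_abs_homogenize_le_nhds f hfull hforced hg
        (ne_zero_of_mem_unit_sphere ⟨u, hu⟩)
      exact ⟨_, mem_nhdsWithin_of_mem_nhds hK, K, fun v hv => hv⟩
  -- Enlarging `K` to at least 1 makes it positive, so that it can be inverted later.
  refine ⟨max K 1, lt_max_of_lt_right one_pos, fun u hu => ?_⟩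
  have hnorm : ‖u‖ ≠ 0 := norm_ne_zero_iff.2 hu
  have hsphere : ‖u‖⁻¹ • u ∈ Metric.sphere (0 : Fin (n + 1) → ℝ) 1 := by
    rw [mem_sphere_zero_iff_norm, norm_smul, norm_inv, norm_norm, inv_mul_cancel₀ hnorm]
  have h := hK _ hsphere
  rw [eval_smul_of_isHomogeneous (isHomogeneous_homogenize _ _),
    eval_smul_of_isHomogeneous (isHomogeneous_homogenize _ _), abs_mul,
    abs_of_pos (by positivity), mul_left_comm] at h
  refine (le_of_mul_le_mul_left h (by positivity)).trans ?_
  exact mul_le_mul_of_nonneg_right (le_max_left _ _) (eval_homogenize_sumSqBasis_nonneg f u)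

lemma noZerosAtInfinity_sumSqBasis (hforced : projForcedZeros d A = ∅) :
    NoZerosAtInfinity (2 * d) (sumSqBasis f) := by
  intro x hx h
  refine Set.notMem_empty (extendVec x 0) (hforced ▸ ⟨fun h0 => hx ?_,
    eval_homogenize_eq_zero_of_sumSqBasis f h, fun a _ t hat => hx ?_⟩)
  · ext i
    rw [← extendVec_castSucc x 0 i, h0]
    rfl
  · have ht := congrFun hat (Fin.last n)
    rw [Pi.smul_apply, extendVec_last, extendVec_last, smul_eq_mul, mul_one] at ht
    ext i
    rw [← extendVec_castSucc x 0 i, hat, ← ht, zero_smul]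
    rfl

/-- With `c = 1 / (2K)` at least half of the sum of squares survives, at infinity as well; the
latter fixes the degree of the perturbed polynomial. -/
lemma exists_psd_perturbation (hfull : IsFull d A) (hforced : projForcedZeros d A = ∅)
    {g : MvPolynomial (Fin n) ℝ} (hg : g ∈ singularSpace (2 * d) A) :
    ∃ c : ℝ, 0 < c ∧ IsPsd (sumSqBasis f + C c * g) ∧
      NoZerosAtInfinity (2 * d) (sumSqBasis f + C c * g) := by
  obtain ⟨K, hK, hle⟩ := exists_abs_homogenize_le f hfull hforced hg
  have hdeg : (sumSqBasis f + C (1 / (2 * K)) * g).totalDegree ≤ 2 * d := by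
    rw [C_mul']
    exact (totalDegree_add _ _).trans
      (max_le (totalDegree_sumSqBasis_le f) ((totalDegree_smul_le _ _).trans hg.1))
  have key : ∀ u : Fin (n + 1) → ℝ, u ≠ 0 →
      1 / 2 * eval u (homogenize (2 * d) (sumSqBasis f)) ≤
        eval u (homogenize (2 * d) (sumSqBasis f + C (1 / (2 * K)) * g)) := by
    intro u hu
    rw [C_mul', homogenize_add, homogenize_smul, map_add, smul_eval]
    have h1 := neg_le_of_abs_le (hle u hu)
    have h2 : 1 / (2 * K) * -(K * eval u (homogenize (2 * d) (sumSqBasis f))) ≤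
        1 / (2 * K) * eval u (homogenize (2 * d) g) :=
      mul_le_mul_of_nonneg_left h1 (by positivity)
    have h3 : 1 / (2 * K) * -(K * eval u (homogenize (2 * d) (sumSqBasis f))) =
        -(1 / 2 * eval u (homogenize (2 * d) (sumSqBasis f))) := by
      field_simp
    linarith
  refine ⟨1 / (2 * K), by positivity, fun x => ?_, fun x hx => ?_⟩
  · have hx : extendVec x 1 ≠ 0 := fun h => by
      have := congrFun h (Fin.last n)
      rw [extendVec_last] at this
      simp at this
    rw [← eval_homogenize_one hdeg]
    exact (mul_nonneg (by norm_num) (eval_homogenize_sumSqBasis_nonneg f _)).trans (key _ hx)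
  · have hx' : extendVec x 0 ≠ 0 := fun h => hx (by
      ext i
      rw [← extendVec_castSucc x 0 i, h]
      rfl)
    have h1 := lt_of_le_of_ne (eval_homogenize_sumSqBasis_nonneg f (extendVec x 0))
      (Ne.symm (noZerosAtInfinity_sumSqBasis f hforced x hx))
    exact (lt_of_lt_of_le (mul_pos (by norm_num) h1) (key _ hx')).ne'

lemma NoZerosAtInfinity.le_totalDegree [Nonempty (Fin n)] {e : ℕ} {p : MvPolynomial (Fin n) ℝ}
    (hp : NoZerosAtInfinity e p) : e ≤ p.totalDegree := by
  by_contra! h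
  refine hp (fun _ => 1) (fun h0 => ?_) ?_
  · exact one_ne_zero (congrFun h0 (Classical.arbitrary _))
  · rw [eval_homogenize_zero, homogeneousComponent_eq_zero _ _ h, map_zero]

end Domination

/-! ### Sums of squares vanishing on `A` -/

section SumSq

open Filter Topology

variable {n : ℕ}

/-- The top form is the limit of `t ^ d * p(x / t)` as `t` decreases to 0. -/
lemma IsPsd.eval_homogeneousComponent_nonneg {p : MvPolynomial (Fin n) ℝ} (hp : IsPsd p) {d : ℕ}
    (hd : p.totalDegree ≤ d) (x : Fin n → ℝ) : 0 ≤ eval x (homogeneousComponent d p) := by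
  rw [← eval_homogenize_zero]
  have h : Tendsto (fun t : ℝ => eval (extendVec x t) (homogenize d p)) (𝓝[>] 0)
      (𝓝 (eval (extendVec x 0) (homogenize d p))) :=
    ((continuous_eval_homogenize d p x).tendsto 0).mono_left nhdsWithin_le_nhds
  refine ge_of_tendsto h ?_
  filter_upwards [self_mem_nhdsWithin] with t ht
  have ht' : (0 : ℝ) < t := ht
  rw [eval_homogenize_of_ne_zero hd x ht'.ne']
  exact mul_nonneg (by positivity) (hp _)

lemma eq_zero_of_homogeneousComponent_totalDegree {p : MvPolynomial (Fin n) ℝ}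
    (h : homogeneousComponent p.totalDegree p = 0) : p = 0 := by
  by_contra hp
  obtain ⟨s, hs, hsd⟩ := exists_mem_eq_sup p.support (support_nonempty.2 hp)
    fun s => s.sum fun _ e => e
  have h1 : coeff s (homogeneousComponent p.totalDegree p) = coeff s p := by
    rw [coeff_homogeneousComponent, if_pos]
    exact hsd.symm
  rw [h, coeff_zero] at h1
  exact mem_support_iff.1 hs h1.symm

/-- Top forms of positive polynomials are nonnegative, so they cannot cancel. -/
lemma IsPsd.totalDegree_le_add {p q : MvPolynomial (Fin n) ℝ} (hp : IsPsd p) (hq : IsPsd q) :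
    max p.totalDegree q.totalDegree ≤ (p + q).totalDegree := by
  by_contra! hlt
  set N := max p.totalDegree q.totalDegree with hN
  have hsum : homogeneousComponent N p + homogeneousComponent N q = 0 := by
    rw [← map_add]
    exact homogeneousComponent_eq_zero _ _ hlt
  have hx : ∀ x, eval x (homogeneousComponent N p) = 0 ∧
      eval x (homogeneousComponent N q) = 0 := by
    intro x
    have h1 := hp.eval_homogeneousComponent_nonneg (le_max_left _ _ : p.totalDegree ≤ N) x
    have h2 := hq.eval_homogeneousComponent_nonneg (le_max_right _ _ : q.totalDegree ≤ N) x
    have h3 := congrArg (eval x) hsum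
    rw [map_add, map_zero] at h3
    exact ⟨by linarith, by linarith⟩
  have hp0 : homogeneousComponent N p = 0 := funext fun x => by rw [(hx x).1, map_zero]
  have hq0 : homogeneousComponent N q = 0 := funext fun x => by rw [(hx x).2, map_zero]
  rcases max_choice p.totalDegree q.totalDegree with h | h
  · rw [hN, h] at hp0
    rw [hN, h, eq_zero_of_homogeneousComponent_totalDegree hp0, totalDegree_zero] at hlt
    omega
  · rw [hN, h] at hq0
    rw [hN, h, eq_zero_of_homogeneousComponent_totalDegree hq0, totalDegree_zero] at hlt
    omega

lemma isPsd_of_isSumSq {p : MvPolynomial (Fin n) ℝ} (hp : IsSumSq p) : IsPsd p := by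
  intro x
  induction hp with
  | zero => simp
  | sq_add a _ ih =>
    rw [map_add, map_mul]
    exact add_nonneg (mul_self_nonneg _) ih

/-- Since neither leading forms nor values on `A` can cancel, each square has degree at most `2 * d`
and vanishes on `A`; its root thus lies in `vanishingSpace d A`. -/
lemma mem_vanishingSpaceSq_of_isSumSq {d : ℕ} {A : Set (Fin n → ℝ)} {p : MvPolynomial (Fin n) ℝ}
    (hp : IsSumSq p) (hd : p.totalDegree ≤ 2 * d) (hA : ∀ a ∈ A, eval a p = 0) :
    p ∈ vanishingSpaceSq d A := by
  induction hp with
  | zero => exact zero_mem _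
  | @sq_add h q hq ih =>
    have hh : IsPsd (h * h) := fun x => by
      rw [map_mul]
      exact mul_self_nonneg _
    have hdeg := (hh.totalDegree_le_add (isPsd_of_isSumSq hq)).trans hd
    rw [max_le_iff] at hdeg
    have hval : ∀ a ∈ A, eval a h = 0 ∧ eval a q = 0 := by
      intro a ha
      have h1 := hA a ha
      rw [map_add, map_mul] at h1
      have h2 := mul_self_nonneg (eval a h)
      have h3 := isPsd_of_isSumSq hq a
      exact ⟨mul_self_eq_zero.1 (by linarith), by linarith⟩
    have hhd : h.totalDegree ≤ d := by
      by_cases h0 : h = 0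
      · simp [h0]
      · have := hdeg.1
        rw [totalDegree_mul_of_isDomain h0 h0] at this
        omega
    have hhV : h ∈ vanishingSpace d A := ⟨hhd, fun a ha => (hval a ha).1⟩
    exact add_mem (Submodule.mul_mem_mul hhV hhV) (ih hdeg.2 fun a ha => (hval a ha).2)

lemma not_isSumSq_perturbation {d s : ℕ} {A : Set (Fin n → ℝ)}
    (f : Module.Basis (Fin s) ℝ (vanishingSpace d A)) {g : MvPolynomial (Fin n) ℝ}
    (hg : g ∈ singularSpace (2 * d) A) (hgV : g ∉ vanishingSpaceSq d A) {c : ℝ} (hc : 0 < c) :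
    ¬ IsSumSq (sumSqBasis f + C c * g) := by
  intro h
  rw [C_mul'] at h
  have hmem := mem_vanishingSpaceSq_of_isSumSq (A := A) h ((totalDegree_add _ _).trans
    (max_le (totalDegree_sumSqBasis_le f) ((totalDegree_smul_le _ _).trans hg.1)))
    fun a ha => by
      rw [map_add, smul_eval, eval_sumSqBasis_eq_zero f ha, (hg.2 a ha).1, mul_zero, add_zero]
  have h2 := (Submodule.add_mem_iff_right _ (sumSqBasis_mem_vanishingSpaceSq f)).1 hmem
  exact hgV ((Submodule.smul_mem_iff _ hc.ne').1 h2)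

end SumSq

/-- By commutativity, the spanning products of basis elements are indexed by unordered pairs. -/
lemma finrank_vanishingSpaceSq_le {n d s : ℕ} {A : Set (Fin n → ℝ)}
    (f : Module.Basis (Fin s) ℝ (vanishingSpace d A)) :
    Module.finrank ℝ (vanishingSpaceSq d A) ≤ (s + 1).choose 2 := by
  let F : Sym2 (Fin s) → MvPolynomial (Fin n) ℝ :=
    Sym2.lift ⟨fun i j => (f i : MvPolynomial (Fin n) ℝ) * f j, fun _ _ => mul_comm _ _⟩
  have hle : vanishingSpaceSq d A ≤ Submodule.span ℝ (Set.range F) := by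
    refine Submodule.mul_le.2 fun p hp q hq => ?_
    have h1 := coe_eq_sum_repr f ⟨p, hp⟩
    have h2 := coe_eq_sum_repr f ⟨q, hq⟩
    simp only at h1 h2
    rw [h1, h2, sum_mul_sum]
    refine sum_mem fun i _ => sum_mem fun j _ => ?_
    rw [smul_mul_smul_comm]
    exact Submodule.smul_mem _ _ (Submodule.subset_span ⟨s(i, j), rfl⟩)
  have : Module.Finite ℝ (Submodule.span ℝ (Set.range F)) :=
    Module.Finite.span_of_finite ℝ (Set.finite_range F)
  calc Module.finrank ℝ (vanishingSpaceSq d A)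
      ≤ Module.finrank ℝ (Submodule.span ℝ (Set.range F)) := Submodule.finrank_mono hle
    _ ≤ Fintype.card (Sym2 (Fin s)) := finrank_range_le_card F
    _ = (s + 1).choose 2 := by rw [Sym2.card, Fintype.card_fin]

lemma forcedZeros_eq_empty {n d : ℕ} {A : Set (Fin n → ℝ)} (h : projForcedZeros d A = ∅) :
    forcedZeros d A = ∅ := by
  rw [Set.eq_empty_iff_forall_notMem]
  rintro x ⟨hx, hxA⟩
  refine Set.notMem_empty (extendVec x 1) (h ▸ ⟨fun h0 => ?_, fun p hp => ?_, fun a ha t hat => ?_⟩)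
  · have := congrFun h0 (Fin.last n)
    rw [extendVec_last] at this
    simp at this
  · rw [eval_homogenize_one hp.1]
    exact hx p hp
  · have ht := congrFun hat (Fin.last n)
    rw [Pi.smul_apply, extendVec_last, extendVec_last, smul_eq_mul, mul_one] at ht
    rw [← ht, one_smul] at hat
    have hxa : x = a := by
      ext i
      rw [← extendVec_castSucc x 1 i, hat, extendVec_castSucc]
    exact hxA (hxa ▸ ha)

end HilbertMethod

/-! ### Assembly for seven points -/

theorem theorem4p3 (A : Finset (Fin 2 → ℝ)) (hcard : A.card = 7)
    (hline : ∀ B : Finset (Fin 2 → ℝ), B ⊆ A → B.card = 4 →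
      ¬ Collinear ℝ (B : Set (Fin 2 → ℝ)))
    (hconic : ¬ ∃ q : MvPolynomial (Fin 2) ℝ,
      q.totalDegree = 2 ∧ ∀ a ∈ A, MvPolynomial.eval a q = 0) :
    -- Hilbert's Method applies to `A`
    HilbertsMethodApplies 3 (A : Set (Fin 2 → ℝ)) ∧
    -- it can be carried out with every basis of the cubics through `A` and every sextic `g` that
    -- is singular on `A` and not in the square of that space, and there is at least one such `g`
    (∃ g ∈ singularSpace 6 (A : Set (Fin 2 → ℝ)), g ∉ vanishingSpaceSq 3 (A : Set (Fin 2 → ℝ))) ∧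
    (∀ (s : ℕ) (f : Module.Basis (Fin s) ℝ (vanishingSpace 3 (A : Set (Fin 2 → ℝ))))
      (g : MvPolynomial (Fin 2) ℝ), g ∈ singularSpace 6 (A : Set (Fin 2 → ℝ)) →
        g ∉ vanishingSpaceSq 3 (A : Set (Fin 2 → ℝ)) →
        HilbertConditions 3 (A : Set (Fin 2 → ℝ)) f g ∧
        ∃ c : ℝ, 0 < c ∧ IsPsd (sumSqBasis f + MvPolynomial.C c * g) ∧
          ¬ IsSumSq (sumSqBasis f + MvPolynomial.C c * g)) ∧
    -- a positive sextic vanishing on `A` that is not a sum of squares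
    (∃ p : MvPolynomial (Fin 2) ℝ, p.totalDegree = 6 ∧ IsPsd p ∧
      (∀ a ∈ A, MvPolynomial.eval a p = 0) ∧ ¬ IsSumSq p) ∧
    -- `A` is full, without forced zeros (even at infinity), and the dimension count
    IsFull 3 (A : Set (Fin 2 → ℝ)) ∧
    projForcedZeros 3 (A : Set (Fin 2 → ℝ)) = ∅ ∧
    Module.finrank ℝ (vanishingSpace 3 (A : Set (Fin 2 → ℝ))) = 3 ∧
    Module.finrank ℝ (vanishingSpaceSq 3 (A : Set (Fin 2 → ℝ))) ≤ 6 ∧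
    7 ≤ Module.finrank ℝ (singularSpace 6 (A : Set (Fin 2 → ℝ))) := by
  have hA : (A : Set (Fin 2 → ℝ)).Nonempty := by
    rw [Finset.coe_nonempty, ← Finset.card_pos, hcard]
    norm_num
  have hC : ∀ q : MvPolynomial (Fin 2) ℝ, q.totalDegree ≤ 2 →
      (∀ a ∈ A, MvPolynomial.eval a q = 0) → q = 0 := fun q hq hqA =>
    eq_zero_of_vanishing_of_totalDegree_le_two hA hconic hq hqA
  obtain ⟨p, hpA, hp⟩ := exists_noConicOffPoint hcard hC
  have hforced := hp.projForcedZeros_eq_empty hcard hline hpA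
  have hfull := isFull_three hcard hline hC
  have hdim := hp.finrank_vanishingSpace hcard hline hpA
  let b : Module.Basis (Fin 3) ℝ (vanishingSpace 3 (A : Set (Fin 2 → ℝ))) :=
    Module.finBasisOfFinrankEq ℝ _ hdim
  have hsq : Module.finrank ℝ (vanishingSpaceSq 3 (A : Set (Fin 2 → ℝ))) ≤ 6 :=
    (finrank_vanishingSpaceSq_le b).trans (by decide)
  have hsing : 7 ≤ Module.finrank ℝ (singularSpace 6 (A : Set (Fin 2 → ℝ))) := by
    have := finrank_singularSpace_ge 6 A
    rw [finrank_sextics, hcard] at this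
    omega
  have hex : ∃ g ∈ singularSpace 6 (A : Set (Fin 2 → ℝ)),
      g ∉ vanishingSpaceSq 3 (A : Set (Fin 2 → ℝ)) := by
    -- Otherwise a space of dimension at least 7 would lie in one of dimension at most 6;
    -- monotonicity of `finrank` needs the larger space to be finite-dimensional.
    by_contra! H
    have : Module.Finite ℝ (vanishingSpaceSq 3 (A : Set (Fin 2 → ℝ))) :=
      Module.Finite.iff_fg.2 ((Module.Finite.iff_fg.1 inferInstance).mul
        (Module.Finite.iff_fg.1 inferInstance))
    have := Submodule.finrank_mono (show singularSpace 6 (A : Set (Fin 2 → ℝ)) ≤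
      vanishingSpaceSq 3 (A : Set (Fin 2 → ℝ)) from fun g hg => H g hg)
    omega
  have hcond : ∀ (s : ℕ) (f : Module.Basis (Fin s) ℝ (vanishingSpace 3 (A : Set (Fin 2 → ℝ))))
      (g : MvPolynomial (Fin 2) ℝ), g ∈ singularSpace 6 (A : Set (Fin 2 → ℝ)) →
        g ∉ vanishingSpaceSq 3 (A : Set (Fin 2 → ℝ)) →
        HilbertConditions 3 (A : Set (Fin 2 → ℝ)) f g := fun s f g hg hgV =>
    { finite := A.finite_toSet
      finite_forcedZeros := by
        rw [forcedZeros_eq_empty hforced]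
        exact Set.finite_empty
      full := hfull
      noZerosAtInfinity := noZerosAtInfinity_sumSqBasis f hforced
      mem_singularSpace := hg
      notMem_vanishingSpaceSq := hgV
      pos_forcedZeros := by simp [forcedZeros_eq_empty hforced] }
  obtain ⟨g, hg, hgV⟩ := hex
  refine ⟨⟨3, b, g, hcond 3 b g hg hgV⟩, ⟨g, hg, hgV⟩, fun s f g hg hgV =>
    ⟨hcond s f g hg hgV, ?_⟩, ?_, hfull, hforced, hdim, hsq, hsing⟩
  · obtain ⟨c, hc, hpsd, -⟩ := exists_psd_perturbation f hfull hforced hg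
    exact ⟨c, hc, hpsd, not_isSumSq_perturbation f hg hgV hc⟩
  · obtain ⟨c, hc, hpsd, hinf⟩ := exists_psd_perturbation b hfull hforced hg
    refine ⟨sumSqBasis b + MvPolynomial.C c * g, le_antisymm ?_ hinf.le_totalDegree, hpsd,
      fun a ha => ?_, not_isSumSq_perturbation b hg hgV hc⟩
    · rw [MvPolynomial.C_mul']
      exact (MvPolynomial.totalDegree_add _ _).trans (max_le (totalDegree_sumSqBasis_le b)
        ((MvPolynomial.totalDegree_smul_le _ _).trans hg.1))
    · rw [map_add, map_mul, eval_sumSqBasis_eq_zero b ha, (hg.2 a ha).1, mul_zero, add_zero]
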